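/- Let $K$ be a field of characteristic $0$ (for example $K=\mathbb{C}$) and let $\tau(t)\in K[[t_1,t_2,t_3,\dots]]$ be a formal power series in infinitely many variables $t=(t_1,t_2,\dots)$. Write $$[\alpha]=\Bigl(\alpha,\frac{\alpha^2}{2},\frac{\alpha^3}{3},\dots\Bigr),\qquad \xi(t,\lambda)=\sum_{n\ge1}t_n\lambda^n,\qquad \alpha_{ij}=\alpha_i-\alpha_j .$$ Then the following two conditions on $\tau$ are equivalent. (i) (Three term equation) In $K[[x_1,x_2,\dots,\alpha_1,\alpha_2,\alpha_3,\alpha_4]]$, $$\alpha_{12}\alpha_{34}\,\tau(x+[\alpha_1]+[\alpha_2])\,\tau(x+[\alpha_3]+[\alpha_4])-\alpha_{13}\alpha_{24}\,\tau(x+[\alpha_1]+[\alpha_3])\,\tau(x+[\alpha_2]+[\alpha_4])+\alpha_{14}\alpha_{23}\,\tau(x+[\alpha_1]+[\alpha_4])\,\tau(x+[\alpha_2]+[\alpha_3])=0 .$$ (ii) (KP hierarchy, bilinear residue identity) In $K[[t_1,t_2,\dots,t'_1,t'_2,\dots]]$, $$\oint e^{\xi(t'-t,\lambda)}\,\tau\bigl(t'-[\lambda^{-1}]\bigr)\,\tau\bigl(t+[\lambda^{-1}]\bigr)\,\frac{d\lambda}{2\pi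 i}=0 ,$$ where $\oint\cdot\,\frac{d\lambda}{2\pi i}$ is the formal operator that extracts the coefficient of $\lambda^{-1}$; here the exponential is expanded in nonnegative powers of $\lambda$, the product of the two $\tau$-factors in nonnegative powers of $\lambda^{-1}$, and they are multiplied as formal Laurent series in $\lambda$ infinite in both directions (for each monomial in $t,t'$ only finitely many products contribute to each coefficient). -/

import Mathlib

noncomputable section

namespace KP

open MvPowerSeries

/-- `[a] = (a, a²/2, a³/3, …)`, the component with index `n ≥ 1` being `aⁿ / n`. -/
def bracket {σ K : Type*} [Field K] (a : MvPowerSeries σ K) : ℕ+ → MvPowerSeries σ K :=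
  fun n => ((n : ℕ) : K)⁻¹ • a ^ (n : ℕ)

/-- `ξ(t, lam) = ∑_{n ≥ 1} tₙ lamⁿ`, as a power series in `lam`. -/
def xi {R : Type*} [CommRing R] (t : ℕ+ → R) : PowerSeries R :=
  PowerSeries.mk fun n => if h : 0 < n then t ⟨n, h⟩ else 0

/-- `τ(v)`: the value of the formal power series `τ(t₁, t₂, …)` at `tₙ = vₙ`. -/
def eval {σ K : Type*} [Field K] (τ : MvPowerSeries ℕ+ K) (v : ℕ+ → MvPowerSeries σ K) :
    MvPowerSeries σ K :=
  MvPowerSeries.subst v τ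

/-! ### The three term equation -/

/-- The variables `x₁, x₂, …`, inside `K⟦x₁, x₂, …, α₁, α₂, α₃, α₄⟧`. -/
def x (K : Type*) [Field K] : ℕ+ → MvPowerSeries (ℕ+ ⊕ Fin 4) K := fun n => X (Sum.inl n)

/-- The parameters `α₁, …, α₄` (numbered from `0`), inside `K⟦x₁, x₂, …, α₁, α₂, α₃, α₄⟧`. -/
def α (K : Type*) [Field K] (i : Fin 4) : MvPowerSeries (ℕ+ ⊕ Fin 4) K := X (Sum.inr i)

/-- The two-point function `τ(x + [αᵢ] + [αⱼ])`. -/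
def twoPoint {K : Type*} [Field K] (τ : MvPowerSeries ℕ+ K) (i j : Fin 4) :
    MvPowerSeries (ℕ+ ⊕ Fin 4) K :=
  eval τ (x K + bracket (α K i) + bracket (α K j))

/-- The three term equation for `τ`, an identity in `K⟦x₁, x₂, …, α₁, α₂, α₃, α₄⟧`. -/
def ThreeTermEquation {K : Type*} [Field K] (τ : MvPowerSeries ℕ+ K) : Prop :=
  (α K 0 - α K 1) * (α K 2 - α K 3) * twoPoint τ 0 1 * twoPoint τ 2 3
    - (α K 0 - α K 2) * (α K 1 - α K 3) * twoPoint τ 0 2 * twoPoint τ 1 3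
    + (α K 0 - α K 3) * (α K 1 - α K 2) * twoPoint τ 0 3 * twoPoint τ 1 2 = 0

/-! ### Formal Laurent series in `lam`, infinite in both directions

A formal series `∑_{n ∈ ℤ} aₙ lamⁿ` is the function `n ↦ aₙ`. -/

/-- The power series `∑_{n ≥ 0} fₙ lamⁿ` as a two-sided series in `lam`. -/
def inLam {R : Type*} [CommRing R] (f : PowerSeries R) : ℤ → R :=
  fun n => if 0 ≤ n then PowerSeries.coeff n.toNat f else 0

/-- The power series `∑_{n ≥ 0} fₙ lam⁻ⁿ` in `lam⁻¹` as a two-sided series in `lam`. -/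
def inLamInv {R : Type*} [CommRing R] (f : PowerSeries R) : ℤ → R :=
  fun n => if n ≤ 0 then PowerSeries.coeff (-n).toNat f else 0

/-- The product of two-sided series whose coefficients are themselves formal power series: the
coefficient of `lamⁿ` is `∑_{i ∈ ℤ} aᵢ b_{n - i}`, an infinite sum of formal power series that is
formed monomial by monomial. -/
def mulLaurent {σ K : Type*} [Field K] (a b : ℤ → MvPowerSeries σ K) : ℤ → MvPowerSeries σ K :=
  fun n d => ∑ᶠ i : ℤ, MvPowerSeries.coeff d (a i * b (n - i))

/-- The operator `∮ · dlam/(2πi)`, which extracts the coefficient of `lam⁻¹`. -/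
def residue {R : Type*} (a : ℤ → R) : R := a (-1)

/-! ### The KP hierarchy

The time variables `t₁, t₂, …` are `X (Sum.inl n)` and `t'₁, t'₂, …` are `X (Sum.inr n)`. In the
ring `K⟦t, t', lam⁻¹⟧` the additional variable `lam⁻¹` is `X none`. -/

/-- The exponential factor `exp ξ(t' - t, lam)`, a power series in `lam` over `K⟦t, t'⟧`. -/
def expFactor (K : Type*) [Field K] [CharZero K] : PowerSeries (MvPowerSeries (ℕ+ ⊕ ℕ+) K) :=
  (PowerSeries.exp K).subst
    (xi fun n => (X (Sum.inr n) - X (Sum.inl n) : MvPowerSeries (ℕ+ ⊕ ℕ+) K))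

/-- The variable `lam⁻¹` of `K⟦t, t', lam⁻¹⟧`. -/
def lamInv (K : Type*) [Field K] : MvPowerSeries (Option (ℕ+ ⊕ ℕ+)) K := X none

/-- The variables `t₁, t₂, …` of `K⟦t, t', lam⁻¹⟧`. -/
def t (K : Type*) [Field K] : ℕ+ → MvPowerSeries (Option (ℕ+ ⊕ ℕ+)) K :=
  fun n => X (some (Sum.inl n))

/-- The variables `t'₁, t'₂, …` of `K⟦t, t', lam⁻¹⟧`. -/
def t' (K : Type*) [Field K] : ℕ+ → MvPowerSeries (Option (ℕ+ ⊕ ℕ+)) K :=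
  fun n => X (some (Sum.inr n))

/-- The factor `τ(t' - [lam⁻¹]) τ(t + [lam⁻¹])`, as a power series in `lam⁻¹` over `K⟦t, t'⟧`. -/
def tauFactor {K : Type*} [Field K] (τ : MvPowerSeries ℕ+ K) :
    PowerSeries (MvPowerSeries (ℕ+ ⊕ ℕ+) K) :=
  MvPowerSeries.optionEquivLeft (ℕ+ ⊕ ℕ+) K
    (eval τ (t' K - bracket (lamInv K)) * eval τ (t K + bracket (lamInv K)))

/-- The KP hierarchy (bilinear residue identity):
`∮ exp(ξ(t' - t, lam)) τ(t' - [lam⁻¹]) τ(t + [lam⁻¹]) dlam/(2πi) = 0` in `K⟦t, t'⟧`. -/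
def IsKPTau {K : Type*} [Field K] [CharZero K] (τ : MvPowerSeries ℕ+ K) : Prop :=
  residue (mulLaurent (inLam (expFactor K)) (inLamInv (tauFactor τ))) = 0

/-! ### The substitutions and the infinite sums above are well defined -/

theorem hasSubst_bracket {σ K : Type*} [Field K] {a : MvPowerSeries σ K}
    (ha : constantCoeff a = 0) : HasSubst (bracket a) where
  const_coeff n := by
    simp [bracket, ha, smul_eq_C_mul]
  coeff_zero d := by
    have hfin : {n : ℕ+ | (n : ℕ) ≤ d.degree}.Finite :=
      Set.Finite.preimage (f := fun n : ℕ+ => (n : ℕ)) PNat.coe_injective.injOn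
        (Set.finite_Iic d.degree)
    refine hfin.subset fun n hn => ?_
    by_contra hlt
    simp only [Set.mem_ofPred_eq, not_le] at hlt hn
    apply hn
    have h1 : (n : ℕ∞) ≤ (a ^ (n : ℕ)).order := by
      refine le_trans ?_ (MvPowerSeries.le_order_pow (n : ℕ))
      have : 1 ≤ a.order := MvPowerSeries.one_le_order_iff_constCoeff_eq_zero.mpr ha
      calc ((n : ℕ) : ℕ∞) = (n : ℕ) • (1 : ℕ∞) := by simp
        _ ≤ _ := nsmul_le_nsmul_right this _
    simp only [bracket, map_smul]
    rw [MvPowerSeries.coeff_of_lt_order, smul_zero]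
    exact lt_of_lt_of_le (by exact_mod_cast hlt) h1

theorem hasSubst_X {ι σ K : Type*} [Field K] {f : ι → σ} (hf : Function.Injective f) :
    HasSubst (fun n => (X (f n) : MvPowerSeries σ K)) where
  const_coeff n := by simp
  coeff_zero d := by
    classical
    have : {n : ι | d = Finsupp.single (f n) 1}.Subsingleton := by
      intro m hm n hn
      apply hf
      have h := hm.symm.trans hn
      exact (Finsupp.single_left_inj one_ne_zero).mp h
    refine this.finite.subset fun n hn => ?_
    simpa [coeff_X] using hn

theorem hasSubst_twoPoint (K : Type*) [Field K] (i j : Fin 4) :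
    HasSubst (x K + bracket (α K i) + bracket (α K j)) :=
  ((hasSubst_X Sum.inl_injective).add (hasSubst_bracket (by simp [α]))).add
    (hasSubst_bracket (by simp [α]))

theorem hasSubst_t_add (K : Type*) [Field K] : HasSubst (t K + bracket (lamInv K)) :=
  (hasSubst_X ((Option.some_injective _).comp Sum.inl_injective)).add
    (hasSubst_bracket (by simp [lamInv]))

theorem hasSubst_t'_sub (K : Type*) [Field K] : HasSubst (t' K - bracket (lamInv K)) := by
  have h := (hasSubst_X (K := K) ((Option.some_injective _).comp
    (Sum.inr_injective (α := ℕ+) (β := ℕ+)))).add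
    ((hasSubst_bracket (a := lamInv K) (by simp [lamInv])).smul (-1))
  convert h using 1
  funext n
  simp [t', sub_eq_add_neg]

theorem hasSubst_xi {R : Type*} [CommRing R] (v : ℕ+ → R) : PowerSeries.HasSubst (xi v) :=
  PowerSeries.HasSubst.of_constantCoeff_zero' (by
    rw [← PowerSeries.coeff_zero_eq_constantCoeff_apply]
    simp [xi])

/-- The weight `∑ n · dₙ` of a monomial in the time variables, `tₙ` and `t'ₙ` having weight `n`. -/
def wt : (ℕ+ ⊕ ℕ+ →₀ ℕ) →+ ℕ :=
  Finsupp.weight (Sum.elim (fun n : ℕ+ => (n : ℕ)) (fun n : ℕ+ => (n : ℕ)))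

theorem coeff_xi_pow (K : Type*) [Field K] (k n : ℕ) (d : ℕ+ ⊕ ℕ+ →₀ ℕ) (h : wt d < n) :
    MvPowerSeries.coeff d (PowerSeries.coeff n
      ((xi fun n => (X (Sum.inr n) - X (Sum.inl n) : MvPowerSeries (ℕ+ ⊕ ℕ+) K)) ^ k)) = 0 := by
  classical
  induction k generalizing n d with
  | zero =>
    have : n ≠ 0 := by omega
    simp [PowerSeries.coeff_one, this]
  | succ k ih =>
    rw [pow_succ, PowerSeries.coeff_mul, map_sum]
    refine Finset.sum_eq_zero fun p hp => ?_
    rw [MvPowerSeries.coeff_mul]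
    refine Finset.sum_eq_zero fun q hq => ?_
    rw [Finset.HasAntidiagonal.mem_antidiagonal] at hp hq
    have hw : wt q.1 + wt q.2 = wt d := by rw [← hq, map_add]
    rcases lt_or_ge (wt q.1) p.1 with h1 | h1
    · rw [ih _ _ h1, zero_mul]
    · have h2 : wt q.2 < p.2 := by omega
      have h3 : 0 < p.2 := by omega
      have e1 : q.2 ≠ Finsupp.single (Sum.inr ⟨p.2, h3⟩) 1 := by
        intro e
        rw [e] at h2
        simp [wt, Finsupp.weight_single] at h2
        exact lt_irrefl _ h2
      have e2 : q.2 ≠ Finsupp.single (Sum.inl ⟨p.2, h3⟩) 1 := by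
        intro e
        rw [e] at h2
        simp [wt, Finsupp.weight_single] at h2
        exact lt_irrefl _ h2
      rw [xi, PowerSeries.coeff_mk, dif_pos h3, map_sub, coeff_X, coeff_X, if_neg e1, if_neg e2,
        sub_zero, mul_zero]

theorem coeff_expFactor (K : Type*) [Field K] [CharZero K] (n : ℕ) (d : ℕ+ ⊕ ℕ+ →₀ ℕ)
    (h : wt d < n) : MvPowerSeries.coeff d (PowerSeries.coeff n (expFactor K)) = 0 := by
  rw [expFactor, PowerSeries.coeff_subst' (hasSubst_xi _)]
  rw [finsum_eq_sum _ (PowerSeries.coeff_subst_finite' (hasSubst_xi _) _ _), map_sum]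
  refine Finset.sum_eq_zero fun k _ => ?_
  rw [map_smul, coeff_xi_pow K k n d h, smul_zero]

/-- Each monomial of the product in the KP hierarchy receives only finitely many contributions. -/
theorem finite_support_mulLaurent {K : Type*} [Field K] [CharZero K] (τ : MvPowerSeries ℕ+ K)
    (n : ℤ) (d : ℕ+ ⊕ ℕ+ →₀ ℕ) :
    (Function.support fun i : ℤ => MvPowerSeries.coeff d
      (inLam (expFactor K) i * inLamInv (tauFactor τ) (n - i))).Finite := by
  classical
  refine (Set.finite_Icc (0 : ℤ) (wt d : ℤ)).subset fun i hi => ?_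
  by_contra hni
  apply hi
  simp only [Set.mem_Icc, not_and_or, not_le] at hni
  rcases hni with h | h
  · simp [inLam, not_le.mpr h]
  · have h0 : 0 ≤ i := by omega
    change MvPowerSeries.coeff d _ = 0
    rw [MvPowerSeries.coeff_mul]
    refine Finset.sum_eq_zero fun q hq => ?_
    rw [Finset.HasAntidiagonal.mem_antidiagonal] at hq
    have hw : wt q.1 + wt q.2 = wt d := by rw [← hq, map_add]
    rw [inLam, if_pos h0, coeff_expFactor K _ _ (by omega), zero_mul]

end KP

end

noncomputable section

namespace KP

open MvPowerSeries

/-! ### Exponentials `exp ξ(w, λ)` and their differential equation -/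

section Exponential

variable {S : Type*} [CommRing S]

/-! Since `ξ([p], λ) = -log(1 - pλ)`, adding `[p]` to the times divides the exponential by `1 - pλ`
(`one_sub_mul_expXi_add`). At times that differ by finitely many brackets the exponential is
therefore rational in `λ`, and expanding it in partial fractions turns the residue into a finite sum
of values of `τ(t' - [a]) τ(t + [a])` at the inverse poles `a` (`mul_subst_kpResidue`).

KP implies three terms: at `t = x + [α₄]`, `t' = x + [α₁] + [α₂] + [α₃]` there are three poles, and
their contributions are the three terms.

Three terms imply KP: at `t = x`, `t' = x + ∑ [aᵢ]` the residue is, up to a Vandermonde-type factor,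
a bilinear sum over the points `aᵢ`. This sum vanishes by induction on the number of points
(`ThreeTermEquation.sum_tauAt_eq_zero`), each step using the three term equation with one parameter
set to `0`. In characteristic zero the power sums of arbitrarily many points are independent enough
that a series vanishing at all these times is zero (`eq_zero_of_subst_pointTimes`). -/

theorem eq_of_derivative_eq_mul [IsAddTorsionFree S] {F₁ F₂ G : PowerSeries S}
    (h₁ : PowerSeries.derivative S F₁ = G * F₁) (h₂ : PowerSeries.derivative S F₂ = G * F₂)
    (h₀ : PowerSeries.constantCoeff F₁ = PowerSeries.constantCoeff F₂) : F₁ = F₂ := by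
  ext n
  induction n using Nat.strong_induction_on with
  | _ n ih =>
    rcases n with _ | n
    · simpa using h₀
    · have e₁ := congrArg (PowerSeries.coeff n) h₁
      have e₂ := congrArg (PowerSeries.coeff n) h₂
      rw [PowerSeries.coeff_derivative, PowerSeries.coeff_mul] at e₁ e₂
      have : ∑ p ∈ Finset.HasAntidiagonal.antidiagonal n, PowerSeries.coeff p.1 G * PowerSeries.coeff p.2 F₁ =
          ∑ p ∈ Finset.HasAntidiagonal.antidiagonal n, PowerSeries.coeff p.1 G * PowerSeries.coeff p.2 F₂ := by
        refine Finset.sum_congr rfl fun p hp => ?_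
        rw [ih p.2 (by have := Finset.HasAntidiagonal.mem_antidiagonal.mp hp; omega)]
      have h : PowerSeries.coeff (n + 1) F₁ * (n + 1) = PowerSeries.coeff (n + 1) F₂ * (n + 1) := by
        rw [e₁, e₂, this]
      rw [← Nat.cast_succ, mul_comm, ← nsmul_eq_mul, mul_comm, ← nsmul_eq_mul] at h
      exact (smul_right_inj (Nat.succ_ne_zero n)).mp h

theorem geometric_mul (p : S) :
    (1 - PowerSeries.C p * PowerSeries.X) * PowerSeries.mk (fun n => p ^ n) = 1 := by
  ext n
  rcases n with _ | n
  · simp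
  · rw [sub_mul, one_mul, mul_assoc, map_sub, PowerSeries.coeff_C_mul,
      PowerSeries.coeff_succ_X_mul]
    simp [PowerSeries.coeff_one, pow_succ']

/-- `exp ξ(w, lam)` as a power series in `lam`. -/
def expXi [Algebra ℚ S] (w : ℕ+ → S) : PowerSeries S :=
  (PowerSeries.exp S).subst (xi w)

theorem constantCoeff_xi (w : ℕ+ → S) : PowerSeries.constantCoeff (xi w) = 0 := by
  rw [← PowerSeries.coeff_zero_eq_constantCoeff_apply]
  simp [xi]

variable [Algebra ℚ S]

theorem derivative_expXi (w : ℕ+ → S) :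
    PowerSeries.derivative S (expXi w) = PowerSeries.derivative S (xi w) * expXi w := by
  rw [expXi, PowerSeries.derivative_subst (hasSubst_xi w), PowerSeries.derivative_exp, mul_comm]

theorem constantCoeff_expXi (w : ℕ+ → S) : PowerSeries.constantCoeff (expXi w) = 1 := by
  rw [← PowerSeries.coeff_zero_eq_constantCoeff_apply, expXi,
    PowerSeries.coeff_subst' (hasSubst_xi w), finsum_eq_single _ 0]
  · simp
  · intro n hn
    simp [constantCoeff_xi, hn]

/-- Both sides solve the same linear first-order equation with constant term 1. -/
theorem expXi_map {T : Type*} [CommRing T] [Algebra ℚ T] [IsAddTorsionFree T] (f : S →+* T)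
    (w : ℕ+ → S) : PowerSeries.map f (expXi w) = expXi fun n => f (w n) := by
  have hx : PowerSeries.map f (xi w) = xi fun n => f (w n) := by
    ext n
    simp only [xi, PowerSeries.coeff_map, PowerSeries.coeff_mk]
    split_ifs <;> simp
  have hd : ∀ F : PowerSeries S, PowerSeries.derivative T (PowerSeries.map f F) =
      PowerSeries.map f (PowerSeries.derivative S F) := by
    intro F
    ext n
    simp [PowerSeries.coeff_derivative]
  refine eq_of_derivative_eq_mul ?_ (derivative_expXi _) ?_
  · rw [hd, derivative_expXi, map_mul, ← hd, hx]
  · rw [← PowerSeries.coeff_zero_eq_constantCoeff_apply, PowerSeries.coeff_map,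
      PowerSeries.coeff_zero_eq_constantCoeff_apply, constantCoeff_expXi, constantCoeff_expXi,
      map_one]

variable [IsAddTorsionFree S]

theorem expXi_zero : expXi (0 : ℕ+ → S) = 1 := by
  have h : xi (0 : ℕ+ → S) = 0 := by
    ext n
    simp only [xi, PowerSeries.coeff_mk, map_zero]
    split_ifs <;> rfl
  refine eq_of_derivative_eq_mul (derivative_expXi _) ?_ (by simp [constantCoeff_expXi])
  rw [h, PowerSeries.derivative_one]
  simp

/-- Adding `[p]` to the times divides `exp ξ(w, lam)` by `1 - p lam`. -/
theorem one_sub_mul_expXi_add (w v : ℕ+ → S) (p : S)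
    (hv : ∀ n : ℕ+, ((n : ℕ) : S) * v n = p ^ (n : ℕ)) :
    (1 - PowerSeries.C p * PowerSeries.X) * expXi (w + v) = expXi w := by
  -- The hypothesis `hv` says `v = [p]`, so `ξ(v, λ)` has derivative `p / (1 - pλ)`.
  have hD : PowerSeries.derivative S (xi (w + v)) =
      PowerSeries.derivative S (xi w) + PowerSeries.C p * PowerSeries.mk (fun n => p ^ n) := by
    ext n
    have := hv ⟨n + 1, n.succ_pos⟩
    simp only [PNat.mk_coe] at this
    push_cast at this
    simp only [xi, PowerSeries.coeff_derivative, PowerSeries.coeff_mk, Nat.succ_pos, dif_pos,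
      map_add, PowerSeries.coeff_C_mul]
    rw [← pow_succ', ← this]
    change (w ⟨n + 1, n.succ_pos⟩ + v ⟨n + 1, n.succ_pos⟩) * ((n : S) + 1) = _
    ring
  refine eq_of_derivative_eq_mul ?_ (derivative_expXi _) ?_
  · rw [Derivation.leibniz, derivative_expXi, hD]
    simp only [map_sub, PowerSeries.derivative_one, Derivation.leibniz, PowerSeries.derivative_C,
      PowerSeries.derivative_X, smul_eq_mul]
    linear_combination (PowerSeries.C p * expXi (w + v)) * geometric_mul p
  · simp [constantCoeff_expXi]

end Exponential

/-! ### Partial fractions and complete homogeneous symmetric functions -/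

section PartialFractions

variable {ι F : Type*} [DecidableEq ι] [Field F]

/-- `∑_{i ∈ s} aᵢᵏ / ∏_{j ∈ s, j ≠ i} (aᵢ - aⱼ)`. -/
def dividedPower (a : ι → F) (s : Finset ι) (k : ℕ) : F :=
  ∑ i ∈ s, a i ^ k * (∏ j ∈ s.erase i, (a i - a j))⁻¹

/-- The factor `aᵢ - aₚ` kills the term `i = p` and cancels one factor of every other denominator.
-/
theorem sum_sub_mul_inv_prod_erase (a : ι → F) (ha : Function.Injective a) (s : Finset ι) {p : ι}
    (hp : p ∈ s) (f : ι → F) :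
    ∑ i ∈ s, (a i - a p) * f i * (∏ j ∈ s.erase i, (a i - a j))⁻¹ =
      ∑ i ∈ s.erase p, f i * (∏ j ∈ (s.erase p).erase i, (a i - a j))⁻¹ := by
  rw [← Finset.add_sum_erase s _ hp, sub_self, zero_mul, zero_mul, zero_add]
  refine Finset.sum_congr rfl fun i hi => ?_
  have hip : i ≠ p := Finset.ne_of_mem_erase hi
  have h0 : a i - a p ≠ 0 := sub_ne_zero.mpr (ha.ne hip)
  rw [← Finset.mul_prod_erase (s.erase i) (fun j => a i - a j)
    (Finset.mem_erase.mpr ⟨hip.symm, hp⟩), Finset.erase_right_comm, mul_inv]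
  field_simp

theorem dividedPower_succ_sub (a : ι → F) (ha : Function.Injective a) (s : Finset ι) {p : ι}
    (hp : p ∈ s) (k : ℕ) :
    dividedPower a s (k + 1) - a p * dividedPower a s k = dividedPower a (s.erase p) k := by
  rw [dividedPower, dividedPower, dividedPower, ← sum_sub_mul_inv_prod_erase a ha s hp,
    Finset.mul_sum, ← Finset.sum_sub_distrib]
  refine Finset.sum_congr rfl fun i _ => ?_
  ring

/-- This is Lagrange interpolation: the divided difference of `zᵏ` over `k + 1` points is its
leading coefficient, and over more points it is zero. -/
theorem dividedPower_eq_ite (a : ι → F) (ha : Function.Injective a) (s : Finset ι) (k : ℕ)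
    (hk : k < s.card) : dividedPower a s k = if k + 1 = s.card then 1 else 0 := by
  obtain ⟨m, hm⟩ : ∃ m, s.card = m + 1 := ⟨s.card - 1, by omega⟩
  induction m generalizing s k with
  | zero =>
    obtain ⟨p, rfl⟩ := Finset.card_eq_one.mp hm
    obtain rfl : k = 0 := by omega
    simp [dividedPower]
  | succ m ih =>
    have step : ∀ {p}, p ∈ s → ∀ k, k < m + 1 →
        dividedPower a (s.erase p) k = if k + 1 = m + 1 then 1 else 0 := by
      intro p hp k hk
      have hc : (s.erase p).card = m + 1 := by rw [Finset.card_erase_of_mem hp]; omega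
      rw [ih _ _ (by omega) hc, hc]
    have hzero : ∀ k, k < m + 1 → dividedPower a s k = 0 := by
      intro k hk
      -- Erasing `p` and erasing `q` give the same value, so the two recursions differ by `(aₚ -
      -- a_q)` times the divided power, which must vanish.
      obtain ⟨p, hp, q, hq, hpq⟩ := Finset.one_lt_card.mp (by omega : 1 < s.card)
      have h₁ := dividedPower_succ_sub a ha s hp k
      have h₂ := dividedPower_succ_sub a ha s hq k
      rw [step hp k hk] at h₁
      rw [step hq k hk] at h₂
      have : (a p - a q) * dividedPower a s k = 0 := by linear_combination h₂ - h₁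
      exact (mul_eq_zero.mp this).resolve_left (sub_ne_zero.mpr (ha.ne hpq))
    split_ifs with h
    · obtain rfl : k = m + 1 := by omega
      obtain ⟨p, hp⟩ := Finset.card_pos.mp (by omega : 0 < s.card)
      have h₁ := dividedPower_succ_sub a ha s hp m
      rwa [hzero m (by omega), mul_zero, sub_zero, step hp m (by omega), if_pos rfl] at h₁
    · exact hzero k (by omega)

/-- The coefficients of `∏_{i ∈ s} (1 - aᵢ lam)⁻¹`. -/
theorem coeff_eq_dividedPower (a : ι → F) (ha : Function.Injective a)
    (g : Finset ι → PowerSeries F) (h0 : g ∅ = 1)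
    (hg : ∀ s, ∀ p ∈ s, (1 - PowerSeries.C (a p) * PowerSeries.X) * g s = g (s.erase p))
    (s : Finset ι) (m : ℕ) (hs : s.card = m + 1) (n : ℕ) :
    PowerSeries.coeff n (g s) = dividedPower a s (n + m) := by
  have hc : ∀ s, ∀ p ∈ s, PowerSeries.coeff 0 (g s) = PowerSeries.coeff 0 (g (s.erase p)) := by
    intro s p hp
    rw [← hg s p hp]
    simp [sub_mul, mul_assoc]
  have hc' : ∀ s, ∀ p ∈ s, ∀ n, PowerSeries.coeff (n + 1) (g s) - a p * PowerSeries.coeff n (g s) =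
      PowerSeries.coeff (n + 1) (g (s.erase p)) := by
    intro s p hp n
    rw [← hg s p hp, sub_mul, one_mul, mul_assoc, map_sub, PowerSeries.coeff_C_mul,
      PowerSeries.coeff_succ_X_mul]
  have hone : ∀ s, PowerSeries.coeff 0 (g s) = 1 := by
    intro s
    induction s using Finset.induction_on with
    | empty => simp [h0]
    | insert p s hp ih => rw [hc _ p (Finset.mem_insert_self p s), Finset.erase_insert hp, ih]
  -- Both sides satisfy `F s (n + 1) - aₚ F s n = F (s.erase p) (n + 1)`; the outer induction is on
  -- the number of points, the inner one on `n`.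
  induction m generalizing s n with
  | zero =>
    obtain ⟨p, rfl⟩ := Finset.card_eq_one.mp hs
    induction n with
    | zero => simp [hone, dividedPower]
    | succ n ih =>
      have h₁ := hc' {p} p (Finset.mem_singleton_self p) n
      rw [Finset.erase_singleton, h0, PowerSeries.coeff_one, if_neg (by omega), ih] at h₁
      rw [sub_eq_zero.mp h₁]
      simp [dividedPower, pow_succ']
  | succ m ihm =>
    obtain ⟨p, hp⟩ := Finset.card_pos.mp (by omega : 0 < s.card)
    induction n with
    | zero => rw [hone, dividedPower_eq_ite a ha s _ (by omega), if_pos (by omega)]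
    | succ n ih =>
      have h₁ := hc' s p hp n
      have h₂ := dividedPower_succ_sub a ha s hp (n + (m + 1))
      rw [ihm (s.erase p) (by rw [Finset.card_erase_of_mem hp]; omega), ih] at h₁
      rw [show n + (m + 1) + 1 = n + 1 + (m + 1) by omega] at h₂
      rw [show n + 1 + m = n + (m + 1) by omega] at h₁
      linear_combination h₁ - h₂

end PartialFractions

/-! ### Substitution into `eval` and `bracket` -/

section Substitution

variable {σ ρ K : Type*} [Field K]

instance [CharZero K] : IsAddTorsionFree (MvPowerSeries σ K) :=
  inferInstanceAs (IsAddTorsionFree ((σ →₀ ℕ) → K))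

theorem subst_eval {f : σ → MvPowerSeries ρ K} (hf : HasSubst f) (τ : MvPowerSeries ℕ+ K)
    {v : ℕ+ → MvPowerSeries σ K} (hv : HasSubst v) :
    subst f (eval τ v) = eval τ fun n => subst f (v n) :=
  subst_comp_subst_apply hv hf τ

theorem subst_bracket {f : σ → MvPowerSeries ρ K} (hf : HasSubst f) (a : MvPowerSeries σ K)
    (n : ℕ+) : subst f (bracket a n) = bracket (subst f a) n := by
  rw [bracket, bracket, subst_smul hf, subst_pow hf]

theorem natCast_mul_bracket [CharZero K] (a : MvPowerSeries σ K) (n : ℕ+) :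
    ((n : ℕ) : MvPowerSeries σ K) * bracket a n = a ^ (n : ℕ) := by
  have h : ((n : ℕ) : K) ≠ 0 := Nat.cast_ne_zero.mpr n.ne_zero
  rw [bracket, ← nsmul_eq_mul, ← Nat.cast_smul_eq_nsmul K, smul_smul, mul_inv_cancel₀ h, one_smul]

theorem bracket_zero : bracket (0 : MvPowerSeries σ K) = 0 := by
  funext n
  simp [bracket]

end Substitution

theorem hasSum_of_eq {α β : Type*} [AddCommMonoid α] [TopologicalSpace α] {f g : β → α} {a : α}
    (h : HasSum f a) (e : ∀ i, g i = f i) : HasSum g a := by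
  rwa [funext e]

/-! ### The residue at specialised times -/

section Residue

variable {σ ρ K : Type*} [Field K]

open scoped MvPowerSeries.WithPiTopology

/-- The residue whose vanishing is the KP hierarchy. -/
def kpResidue [CharZero K] (τ : MvPowerSeries ℕ+ K) : MvPowerSeries (ℕ+ ⊕ ℕ+) K :=
  residue (mulLaurent (inLam (expFactor K)) (inLamInv (tauFactor τ)))

theorem hasSum_kpResidue [CharZero K] [UniformSpace K] [DiscreteUniformity K]
    (τ : MvPowerSeries ℕ+ K) :
    HasSum (fun n : ℕ => PowerSeries.coeff n (expFactor K) *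
      PowerSeries.coeff (n + 1) (tauFactor τ)) (kpResidue τ) := by
  rw [WithPiTopology.hasSum_iff_hasSum_coeff]
  intro d
  set f : ℤ → K := fun i => MvPowerSeries.coeff d
    (inLam (expFactor K) i * inLamInv (tauFactor τ) (-1 - i)) with hf
  have hfin : (Function.support f).Finite := finite_support_mulLaurent τ (-1) d
  have h1 : HasSum f (∑ᶠ i, f i) := by
    rw [← tsum_eq_finsum (L := SummationFilter.unconditional ℤ) hfin]
    exact (summable_of_hasFiniteSupport hfin).hasSum
  -- The exponential has no negative powers of `λ`; its `λⁿ` pairs with the coefficient of `λ⁻¹` to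
  -- the power `n + 1`.
  have h2 : HasSum (f ∘ ((↑) : ℕ → ℤ)) (∑ᶠ i, f i) := by
    rw [Function.Injective.hasSum_iff Nat.cast_injective]
    · exact h1
    · intro i hi
      have : ¬ 0 ≤ i := fun h => hi ⟨i.toNat, by simpa using h⟩
      simp [hf, inLam, this]
  change HasSum _ (∑ᶠ i, f i)
  convert h2 using 1
  funext n
  have e : (-(-1 - (n : ℤ))).toNat = n + 1 := by omega
  have e' : (-1 - (n : ℤ)) ≤ 0 := by omega
  simp only [Function.comp, hf, inLam, inLamInv, e, e', if_true, Int.toNat_natCast,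
    Int.natCast_nonneg]

theorem expFactor_eq_expXi [CharZero K] :
    expFactor K = expXi fun n => (X (Sum.inr n) - X (Sum.inl n) : MvPowerSeries (ℕ+ ⊕ ℕ+) K) := by
  ext n : 1
  rw [expFactor, expXi, PowerSeries.coeff_subst' (hasSubst_xi _),
    PowerSeries.coeff_subst' (hasSubst_xi _)]
  refine finsum_congr fun k => ?_
  ext d
  rw [PowerSeries.coeff_exp, PowerSeries.coeff_exp, algebraMap_smul, smul_eq_mul,
    ← Algebra.smul_def]

/-- Group the monomials of `G` by their exponent in the variable `none`; the substitution is
continuous, so the sum may be formed fibre by fibre. -/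
theorem hasSum_subst_option [UniformSpace K] [DiscreteUniformity K]
    {v : Option σ → MvPowerSeries ρ K} (hv : HasSubst v) (hv' : HasSubst (v ∘ some))
    (G : MvPowerSeries (Option σ) K) :
    HasSum (fun n => subst (v ∘ some) (PowerSeries.coeff n (optionEquivLeft σ K G)) * v none ^ n)
      (subst v G) := by
  have h1 := (WithPiTopology.hasSum_of_monomials_self G).map (substAlgHom hv)
    (by rw [coe_substAlgHom hv]; exact continuous_subst hv)
  rw [coe_substAlgHom hv] at h1
  have h2 := (Finsupp.optionEquiv.symm.hasSum_iff).mpr h1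
  refine h2.prod_fiberwise fun n => ?_
  have h3 := ((WithPiTopology.hasSum_of_monomials_self
    (PowerSeries.coeff n (optionEquivLeft σ K G))).map (substAlgHom hv')
    (by rw [coe_substAlgHom hv']; exact continuous_subst hv')).mul_right (v none ^ n)
  rw [coe_substAlgHom hv'] at h3
  refine hasSum_of_eq h3 fun d => ?_
  have e : Finsupp.optionEquiv.symm (n, d) = d.optionElim n := rfl
  simp only [Function.comp, e]
  rw [subst_monomial hv, subst_monomial hv', coeff_coeff_optionEquivLeft,
    Finsupp.prod_option_index _ _ (fun _ => pow_zero _) (fun _ _ _ => pow_add _ _ _),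
    Finsupp.optionElim_apply_none, Finsupp.some_optionElim, mul_left_comm, mul_comm]
  rfl

theorem hasSubst_sumElim {ι κ : Type*} {u : ι → MvPowerSeries ρ K} {u' : κ → MvPowerSeries ρ K}
    (hu : HasSubst u) (hu' : HasSubst u') : HasSubst (Sum.elim u u') where
  const_coeff i := by
    cases i
    · exact hu.const_coeff _
    · exact hu'.const_coeff _
  coeff_zero d := by
    refine (((hu.coeff_zero d).image Sum.inl).union ((hu'.coeff_zero d).image Sum.inr)).subset ?_
    rintro (i | i) hi
    · exact Or.inl ⟨i, hi, rfl⟩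
    · exact Or.inr ⟨i, hi, rfl⟩

theorem hasSubst_optionElim {ι : Type*} {u : ι → MvPowerSeries ρ K} (hu : HasSubst u)
    {a : MvPowerSeries ρ K} (ha : constantCoeff a = 0) :
    HasSubst (fun o : Option ι => o.elim a u) where
  const_coeff i := by
    cases i
    · simp [ha]
    · exact hu.const_coeff _
  coeff_zero d := by
    refine (((hu.coeff_zero d).image some).union (Set.finite_singleton none)).subset ?_
    rintro (_ | i) hi
    · exact Or.inr rfl
    · exact Or.inl ⟨i, hi, rfl⟩

theorem subst_expFactor [CharZero K] {u u' : ℕ+ → MvPowerSeries ρ K} (hu : HasSubst u)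
    (hu' : HasSubst u') (n : ℕ) :
    subst (Sum.elim u u') (PowerSeries.coeff n (expFactor K)) =
      PowerSeries.coeff n (expXi (u' - u)) := by
  have h := hasSubst_sumElim hu hu'
  have e : expXi (u' - u) = PowerSeries.map (substAlgHom (R := K) h).toRingHom
      (expFactor K) := by
    rw [expFactor_eq_expXi, expXi_map]
    congr 1
    funext n
    simp [subst_sub h, subst_X h]
  rw [e, PowerSeries.coeff_map]
  simp

/-- A residue theorem with denominators cleared by `D`. By `hD` the exponential times `D` is `∑ wᵢ
aᵢ / (1 - aᵢλ)`, so pairing with `G = ∑ gₙ λ⁻ⁿ` gives `∑ wᵢ (G(aᵢ) - g₀)`, where `G(aᵢ)` has `aᵢ` in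
place of `λ⁻¹`. The condition `hw` removes `g₀`. -/
theorem mul_subst_kpResidue [CharZero K] (τ : MvPowerSeries ℕ+ K) {ι : Type*} (s : Finset ι)
    (a : ι → MvPowerSeries ρ K) (ha : ∀ i, constantCoeff (a i) = 0)
    {u u' : ℕ+ → MvPowerSeries ρ K} (hu : HasSubst u) (hu' : HasSubst u')
    (D : MvPowerSeries ρ K) (w : ι → MvPowerSeries ρ K)
    (hD : ∀ n, D * PowerSeries.coeff n (expXi (u' - u)) = ∑ i ∈ s, w i * a i ^ (n + 1))
    (hw : ∑ i ∈ s, w i = 0) :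
    D * subst (Sum.elim u u') (kpResidue τ) =
      ∑ i ∈ s, w i * (eval τ (u' - bracket (a i)) * eval τ (u + bracket (a i))) := by
  let _ : UniformSpace K := ⊥
  have : DiscreteUniformity K := ⟨rfl⟩
  have h := hasSubst_sumElim hu hu'
  set g := fun n => subst (Sum.elim u u') (PowerSeries.coeff n (tauFactor τ)) with hg
  have h1 : HasSum (fun n => ∑ i ∈ s, w i * (g (n + 1) * a i ^ (n + 1)))
      (D * subst (Sum.elim u u') (kpResidue τ)) := by
    have := ((hasSum_kpResidue τ).map (substAlgHom h)
      (by rw [coe_substAlgHom h]; exact continuous_subst h)).mul_left D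
    rw [coe_substAlgHom h] at this
    refine hasSum_of_eq this fun n => ?_
    rw [Function.comp, subst_mul h, subst_expFactor hu hu', ← mul_assoc, hD, Finset.sum_mul]
    refine Finset.sum_congr rfl fun i _ => ?_
    ring
  have h2 : ∀ i, HasSum (fun n => g n * a i ^ n)
      (eval τ (u' - bracket (a i)) * eval τ (u + bracket (a i))) := by
    intro i
    have hi := hasSubst_optionElim h (ha i)
    have := hasSum_subst_option hi h (eval τ (t' K - bracket (lamInv K)) *
      eval τ (t K + bracket (lamInv K)))
    rw [subst_mul hi, subst_eval hi τ (hasSubst_t'_sub K), subst_eval hi τ (hasSubst_t_add K)] at this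
    have e₁ : (fun n => subst (fun o : Option (ℕ+ ⊕ ℕ+) => o.elim (a i) (Sum.elim u u'))
        ((t' K - bracket (lamInv K)) n)) = u' - bracket (a i) := by
      funext n
      rw [Pi.sub_apply, subst_sub hi, subst_bracket hi, t', lamInv, subst_X hi, subst_X hi]
      rfl
    have e₂ : (fun n => subst (fun o : Option (ℕ+ ⊕ ℕ+) => o.elim (a i) (Sum.elim u u'))
        ((t K + bracket (lamInv K)) n)) = u + bracket (a i) := by
      funext n
      rw [Pi.add_apply, subst_add hi, subst_bracket hi, t, lamInv, subst_X hi, subst_X hi]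
      rfl
    rw [e₁, e₂] at this
    exact this
  have h3 := hasSum_sum fun i (_ : i ∈ s) => (h2 i).mul_left (w i)
  -- The residue starts at `g₁`, so the term `n = 0` is split off; it is zero by `hw`.
  rw [← hasSum_nat_add_iff' 1] at h3
  have h4 : ∑ i ∈ Finset.range 1, ∑ j ∈ s, w j * (g i * a j ^ i) = 0 := by
    simp only [Finset.sum_range_one, pow_zero, mul_one, ← Finset.sum_mul, hw, zero_mul]
  rw [h4, sub_zero] at h3
  exact h1.unique h3

end Residue

/-! ### From the KP hierarchy to the three term equation -/

section ThreeTerm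

variable {σ K : Type*} [Field K]

theorem one_sub_mul_expXi_add_bracket [CharZero K] (w : ℕ+ → MvPowerSeries σ K)
    (p : MvPowerSeries σ K) :
    (1 - PowerSeries.C p * PowerSeries.X) * expXi (w + bracket p) = expXi w :=
  one_sub_mul_expXi_add w _ p (natCast_mul_bracket p)

/-- Partial fractions of `(1 - dz) / ((1 - az)(1 - bz)(1 - cz))`, multiplied by the Vandermonde
product so that no division is needed. -/
theorem inv_prod_partial_fractions {R : Type*} [CommRing R] {a b c d z A B C e : R}
    (hA : (1 - a * z) * A = 1) (hB : (1 - b * z) * B = 1) (hC : (1 - c * z) * C = 1)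
    (he : (1 - a * z) * (1 - b * z) * (1 - c * z) * e = 1 - d * z) :
    (a - b) * (a - c) * (b - c) * e =
      (b - c) * (a - d) * a * A + -((a - c) * (b - d)) * b * B + (a - b) * (c - d) * c * C := by
  have h : e = (1 - d * z) * (A * B * C) := by
    calc e = ((1 - a * z) * A) * ((1 - b * z) * B) * ((1 - c * z) * C) * e := by
          rw [hA, hB, hC]; ring
      _ = _ := by rw [← he]; ring
  calc (a - b) * (a - c) * (b - c) * e =
      (b - c) * (a - d) * a * A * ((1 - b * z) * B) * ((1 - c * z) * C) +
        -((a - c) * (b - d)) * b * B * ((1 - a * z) * A) * ((1 - c * z) * C) +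
        (a - b) * (c - d) * c * C * ((1 - a * z) * A) * ((1 - b * z) * B) := by rw [h]; ring
    _ = _ := by rw [hA, hB, hC]; ring

theorem threeTermEquation_of_isKPTau [CharZero K] {τ : MvPowerSeries ℕ+ K} (hτ : IsKPTau τ) :
    ThreeTermEquation τ := by
  have hα : ∀ i, constantCoeff (α K i) = 0 := fun i => by simp [α]
  have hx : HasSubst (x K) := hasSubst_X Sum.inl_injective
  have hb : ∀ i, HasSubst (bracket (α K i)) := fun i => hasSubst_bracket (hα i)
  have hu : HasSubst (x K + bracket (α K 3)) := hx.add (hb 3)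
  have hu' : HasSubst (x K + bracket (α K 0) + bracket (α K 1) + bracket (α K 2)) :=
    ((hx.add (hb 0)).add (hb 1)).add (hb 2)
  -- The weights are the partial fraction coefficients. Moving `[αᵢ]` from `t'` to `t` leaves two
  -- brackets on each side, as in the three term equation.
  have key := mul_subst_kpResidue τ Finset.univ ![α K 0, α K 1, α K 2]
    (by intro i; fin_cases i <;> exact hα _) hu hu'
    ((α K 0 - α K 1) * (α K 0 - α K 2) * (α K 1 - α K 2))
    ![(α K 1 - α K 2) * (α K 0 - α K 3), -((α K 0 - α K 2) * (α K 1 - α K 3)),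
      (α K 0 - α K 1) * (α K 2 - α K 3)] ?_ ?_
  · have h0 : kpResidue τ = 0 := hτ
    have e0 : subst (Sum.elim (x K + bracket (α K 3))
        (x K + bracket (α K 0) + bracket (α K 1) + bracket (α K 2)))
        (0 : MvPowerSeries (ℕ+ ⊕ ℕ+) K) = 0 := by
      rw [← coe_substAlgHom (hasSubst_sumElim hu hu'), map_zero]
    rw [h0, e0, mul_zero] at key
    simp only [Fin.sum_univ_three, Matrix.cons_val] at key
    rw [show x K + bracket (α K 0) + bracket (α K 1) + bracket (α K 2) - bracket (α K 0) =
        x K + bracket (α K 1) + bracket (α K 2) by abel,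
      show x K + bracket (α K 0) + bracket (α K 1) + bracket (α K 2) - bracket (α K 1) =
        x K + bracket (α K 0) + bracket (α K 2) by abel, add_sub_cancel_right,
      add_right_comm _ (bracket (α K 3)), add_right_comm _ (bracket (α K 3)),
      add_right_comm _ (bracket (α K 3))] at key
    simp only [ThreeTermEquation, twoPoint]
    linear_combination -key
  · intro n
    set e := expXi (x K + bracket (α K 0) + bracket (α K 1) + bracket (α K 2) -
      (x K + bracket (α K 3)))
    -- Brackets are peeled off one at a time; what remains is `exp ξ(-[α 3], λ) = 1 - α 3 · λ`, by
    -- `h3`.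
    have h2 := one_sub_mul_expXi_add_bracket (x K + bracket (α K 0) + bracket (α K 1) -
      (x K + bracket (α K 3))) (α K 2)
    have h1 := one_sub_mul_expXi_add_bracket (x K + bracket (α K 0) -
      (x K + bracket (α K 3))) (α K 1)
    have h0 := one_sub_mul_expXi_add_bracket (x K - (x K + bracket (α K 3))) (α K 0)
    have h3 := one_sub_mul_expXi_add_bracket (x K - (x K + bracket (α K 3))) (α K 3)
    rw [sub_add_eq_add_sub] at h0 h1 h2 h3
    rw [sub_self, expXi_zero] at h3
    change _ * e = _ at h2
    rw [mul_one] at h3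
    have g0 := geometric_mul (α K 0)
    have g1 := geometric_mul (α K 1)
    have g2 := geometric_mul (α K 2)
    have hE := inv_prod_partial_fractions g0 g1 g2
      (by rw [mul_assoc, mul_assoc, h2, h1, h0, h3] :
        (1 - PowerSeries.C (α K 0) * PowerSeries.X) * (1 - PowerSeries.C (α K 1) * PowerSeries.X) *
          (1 - PowerSeries.C (α K 2) * PowerSeries.X) * e =
        1 - PowerSeries.C (α K 3) * PowerSeries.X)
    have := congrArg (PowerSeries.coeff n) hE
    simp only [← map_mul, ← map_sub, ← map_neg, map_add, PowerSeries.coeff_C_mul,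
      PowerSeries.coeff_mk] at this
    simp only [Fin.sum_univ_three, Matrix.cons_val]
    rw [this]
    ring
  · simp only [Fin.sum_univ_three, Matrix.cons_val]
    ring

theorem ThreeTermEquation.apply {τ : MvPowerSeries ℕ+ K} (hτ : ThreeTermEquation τ)
    {u : ℕ+ → MvPowerSeries σ K} (hu : HasSubst u) (a : Fin 4 → MvPowerSeries σ K)
    (ha : ∀ i, constantCoeff (a i) = 0) :
    (a 0 - a 1) * (a 2 - a 3) * eval τ (u + bracket (a 0) + bracket (a 1)) *
        eval τ (u + bracket (a 2) + bracket (a 3)) -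
      (a 0 - a 2) * (a 1 - a 3) * eval τ (u + bracket (a 0) + bracket (a 2)) *
        eval τ (u + bracket (a 1) + bracket (a 3)) +
      (a 0 - a 3) * (a 1 - a 2) * eval τ (u + bracket (a 0) + bracket (a 3)) *
        eval τ (u + bracket (a 1) + bracket (a 2)) = 0 := by
  have h : HasSubst (Sum.elim u a) := hasSubst_sumElim hu (hasSubst_of_constantCoeff_zero ha)
  have hα : ∀ i, substAlgHom h (α K i) = a i := fun i => by
    rw [coe_substAlgHom, α, subst_X h]; rfl
  have ht : ∀ i j, substAlgHom h (twoPoint τ i j) =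
      eval τ (u + bracket (a i) + bracket (a j)) := by
    intro i j
    rw [coe_substAlgHom, twoPoint, subst_eval h τ (hasSubst_twoPoint K i j)]
    congr 1
    funext n
    rw [Pi.add_apply, Pi.add_apply, subst_add h, subst_add h, subst_bracket h, subst_bracket h,
      x, subst_X h, ← coe_substAlgHom h, hα, hα]
    rfl
  have := congrArg (substAlgHom h) hτ
  simpa only [map_add, map_sub, map_mul, hα, ht, map_zero] using this

end ThreeTerm

/-! ### The addition formula at finitely many points -/

section Points

variable {K : Type*} [Field K]

/-- The times `x₁, x₂, …` inside `K⟦x, a₀, a₁, …⟧`. -/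
def baseTime (K : Type*) [Field K] (n : ℕ+) : MvPowerSeries (ℕ+ ⊕ ℕ) K := X (Sum.inl n)

/-- The points `a₀, a₁, …` inside `K⟦x, a₀, a₁, …⟧`. -/
def point (K : Type*) [Field K] (i : ℕ) : MvPowerSeries (ℕ+ ⊕ ℕ) K := X (Sum.inr i)

/-- `x + ∑_{i ∈ C} [aᵢ]`. -/
def shift (K : Type*) [Field K] (C : Multiset ℕ) : ℕ+ → MvPowerSeries (ℕ+ ⊕ ℕ) K :=
  baseTime K + (C.map fun i => bracket (point K i)).sum

theorem constantCoeff_point (i : ℕ) : constantCoeff (point K i) = 0 := by simp [point]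

theorem point_injective : Function.Injective (point K) := by
  intro i j h
  exact Sum.inr_injective (X_inj.mp h)

theorem shift_cons (C : Multiset ℕ) (i : ℕ) :
    shift K (i ::ₘ C) = shift K C + bracket (point K i) := by
  rw [shift, shift, Multiset.map_cons, Multiset.sum_cons, add_assoc, add_comm (bracket _)]

theorem hasSubst_shift (C : Multiset ℕ) : HasSubst (shift K C) := by
  induction C using Multiset.induction_on with
  | empty =>
    rw [shift, Multiset.map_zero, Multiset.sum_zero, add_zero]
    exact hasSubst_X Sum.inl_injective
  | cons i C ih =>
    rw [shift_cons]
    exact ih.add (hasSubst_bracket (constantCoeff_point i))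

/-- `τ(x + ∑_{i ∈ C} [aᵢ])`. -/
def tauAt (τ : MvPowerSeries ℕ+ K) (C : Multiset ℕ) : MvPowerSeries (ℕ+ ⊕ ℕ) K :=
  eval τ (shift K C)

/-- Setting every point to zero recovers `τ`. This permits cancelling values of `τ` in the addition
formula. -/
theorem tauAt_ne_zero {τ : MvPowerSeries ℕ+ K} (hτ : τ ≠ 0) (C : Multiset ℕ) :
    tauAt τ C ≠ 0 := by
  have h : HasSubst (Sum.elim (X : ℕ+ → MvPowerSeries ℕ+ K) (0 : ℕ → MvPowerSeries ℕ+ K)) :=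
    hasSubst_sumElim HasSubst.X HasSubst.zero
  have hs : ∀ n, substAlgHom h (shift K C n) = X n := by
    intro n
    induction C using Multiset.induction_on with
    | empty =>
      simp only [shift, Multiset.map_zero, Multiset.sum_zero, add_zero, baseTime]
      rw [substAlgHom_X]
      rfl
    | cons i C ih =>
      rw [shift_cons, Pi.add_apply, map_add, ih, coe_substAlgHom, subst_bracket h, point,
        subst_X h, Sum.elim_inr, Pi.zero_apply, bracket_zero, Pi.zero_apply, add_zero]
  intro h0
  apply hτ
  have := congrArg (substAlgHom h) h0
  rw [map_zero, coe_substAlgHom, tauAt, subst_eval h τ (hasSubst_shift C)] at this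
  simp only [← coe_substAlgHom h, hs] at this
  rwa [eval, subst_self] at this

/-- The three term equation with parameters `0, aᵢ, aₚ, a_q`, based at `x + ∑_{j ∈ C} [aⱼ]`. -/
theorem ThreeTermEquation.tauAt_relation {τ : MvPowerSeries ℕ+ K} (hτ : ThreeTermEquation τ)
    (C : Multiset ℕ) (i p q : ℕ) :
    point K i * (point K p - point K q) * tauAt τ (i ::ₘ C) * tauAt τ (p ::ₘ q ::ₘ C) =
      point K p * (point K i - point K q) * tauAt τ (p ::ₘ C) * tauAt τ (i ::ₘ q ::ₘ C) -
      point K q * (point K i - point K p) * tauAt τ (q ::ₘ C) * tauAt τ (i ::ₘ p ::ₘ C) := by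
  have h := hτ.apply (hasSubst_shift C) ![0, point K i, point K p, point K q]
    (by intro j; fin_cases j <;> simp [constantCoeff_point])
  simp only [Matrix.cons_val, bracket_zero, add_zero] at h
  simp only [tauAt, shift_cons]
  rw [add_right_comm _ (bracket (point K q)) (bracket (point K p)),
    add_right_comm _ (bracket (point K q)) (bracket (point K i)),
    add_right_comm _ (bracket (point K p)) (bracket (point K i))]
  linear_combination -h

variable (K) in
/-- The fraction field of `K⟦x, a₀, a₁, …⟧`. -/
abbrev Frac : Type _ := FractionRing (MvPowerSeries (ℕ+ ⊕ ℕ) K)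

variable (K) in
/-- The inclusion of `K⟦x, a₀, a₁, …⟧` in its fraction field. -/
abbrev toFrac : MvPowerSeries (ℕ+ ⊕ ℕ) K →+* Frac K := algebraMap _ _

theorem toFrac_injective : Function.Injective (toFrac K) :=
  FaithfulSMul.algebraMap_injective _ _

theorem toFrac_point_injective : Function.Injective fun i => toFrac K (point K i) :=
  toFrac_injective.comp point_injective

/-- The bilinear addition formula with several points. -/
theorem ThreeTermEquation.sum_tauAt_eq_zero {τ : MvPowerSeries ℕ+ K} (hτ : ThreeTermEquation τ)
    (h0 : τ ≠ 0) (m : ℕ) (s : Finset ℕ) (hs : s.card = m + 2) (C : Multiset ℕ) :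
    ∑ i ∈ s, (toFrac K (point K i) ^ m *
      (toFrac K (tauAt τ ((s.erase i).val + C)) * toFrac K (tauAt τ (i ::ₘ C)))) *
      (∏ j ∈ s.erase i, (toFrac K (point K i) - toFrac K (point K j)))⁻¹ = 0 := by
  -- For two points the two terms cancel by antisymmetry. Otherwise the sum is multiplied by `(aₚ -
  -- a_q) τ(x + [aₚ] + [a_q] + …)`, and `tauAt_relation` splits it into two sums of the shape
  -- `hred`.
  induction m generalizing s C with
  | zero =>
    obtain ⟨p, q, hpq, rfl⟩ := Finset.card_eq_two.mp hs
    have hp : ({p, q} : Finset ℕ).erase p = {q} := by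
      ext; simp; grind
    have hq : ({p, q} : Finset ℕ).erase q = {p} := by
      ext; simp; grind
    rw [Finset.sum_pair hpq, hp, hq]
    simp only [Finset.prod_singleton, Finset.singleton_val, Multiset.singleton_add, pow_zero]
    rw [← neg_sub (toFrac K (point K p)), inv_neg]
    ring
  | succ m ih =>
    obtain ⟨p, hp, q, hq, hpq⟩ := Finset.one_lt_card.mp (by omega : 1 < s.card)
    have hinj := toFrac_point_injective (K := K)
    -- The factor `aᵢ - a_q` removes `q` from `s`, and `q` joins the background `C`: this is the
    -- formula with one point fewer.
    have hred : ∀ q ∈ s, ∑ i ∈ s, (toFrac K (point K i) - toFrac K (point K q)) *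
        (toFrac K (point K i) ^ m * (toFrac K (tauAt τ ((s.erase i).val + C)) *
          toFrac K (tauAt τ (i ::ₘ q ::ₘ C)))) *
        (∏ j ∈ s.erase i, (toFrac K (point K i) - toFrac K (point K j)))⁻¹ = 0 := by
      intro q hq
      rw [sum_sub_mul_inv_prod_erase (fun i => toFrac K (point K i)) hinj s hq,
        ← ih (s.erase q) (by rw [Finset.card_erase_of_mem hq]; omega) (q ::ₘ C)]
      refine Finset.sum_congr rfl fun i hi => ?_
      have hqi : q ∈ s.erase i :=
        Finset.mem_erase.mpr ⟨(Finset.ne_of_mem_erase hi).symm, hq⟩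
      have : (s.erase i).val + C = ((s.erase q).erase i).val + q ::ₘ C := by
        rw [Finset.erase_right_comm, Finset.erase_val (s.erase i), Multiset.add_cons,
          ← Multiset.cons_add, Multiset.cons_erase hqi]
      rw [this]
    have hne : toFrac K (point K p - point K q) * toFrac K (tauAt τ (p ::ₘ q ::ₘ C)) ≠ 0 := by
      rw [← map_mul]
      exact (map_ne_zero_iff _ toFrac_injective).mpr (mul_ne_zero
        (sub_ne_zero.mpr (point_injective.ne hpq)) (tauAt_ne_zero h0 _))
    refine (mul_eq_zero.mp ?_).resolve_left hne
    have hsum := congrArg₂ (fun a b => toFrac K (point K p) * toFrac K (tauAt τ (p ::ₘ C)) * a -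
      toFrac K (point K q) * toFrac K (tauAt τ (q ::ₘ C)) * b) (hred q hq) (hred p hp)
    simp only [mul_zero, sub_zero] at hsum
    rw [← hsum, Finset.mul_sum, Finset.mul_sum, Finset.mul_sum, ← Finset.sum_sub_distrib]
    refine Finset.sum_congr rfl fun i _ => ?_
    have := congrArg (toFrac K) (hτ.tauAt_relation C i p q)
    simp only [map_mul, map_sub] at this ⊢
    linear_combination (toFrac K (point K i) ^ m * toFrac K (tauAt τ ((s.erase i).val + C)) *
      (∏ j ∈ s.erase i, (toFrac K (point K i) - toFrac K (point K j)))⁻¹) * this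

theorem coeff_expXi_shift [CharZero K] (s : Finset ℕ) (m : ℕ) (hs : s.card = m + 1) (n : ℕ) :
    toFrac K (PowerSeries.coeff n (expXi (shift K s.val - shift K 0))) =
      dividedPower (fun i => toFrac K (point K i)) s (n + m) := by
  have h := coeff_eq_dividedPower (fun i => toFrac K (point K i)) toFrac_point_injective
    (fun s => PowerSeries.map (toFrac K) (expXi (shift K s.val - shift K 0))) ?_ ?_ s m hs n
  · rw [← h, PowerSeries.coeff_map]
  · rw [Finset.empty_val, sub_self, expXi_zero, map_one]
  · intro s p hp
    have hv : shift K s.val = shift K (s.erase p).val + bracket (point K p) := by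
      rw [← shift_cons, Finset.erase_val, Multiset.cons_erase hp]
    have := congrArg (PowerSeries.map (toFrac K))
      (one_sub_mul_expXi_add_bracket (shift K (s.erase p).val - shift K 0) (point K p))
    rw [map_mul, map_sub, map_one, map_mul, PowerSeries.map_C, PowerSeries.map_X] at this
    rw [← this, hv, sub_add_eq_add_sub]

/-- Here the exponential is `∏ (1 - aᵢλ)⁻¹`, with partial fraction weights `aᵢᵐ / ∏ (aᵢ - aⱼ)`, so
the residue is the addition formula with empty `C`. The product of all `V k` clears the
denominators. -/
theorem ThreeTermEquation.subst_kpResidue_eq_zero [CharZero K] {τ : MvPowerSeries ℕ+ K}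
    (hτ : ThreeTermEquation τ) (h0 : τ ≠ 0) (m : ℕ) (s : Finset ℕ) (hs : s.card = m + 2) :
    subst (Sum.elim (shift K 0) (shift K s.val)) (kpResidue τ) = 0 := by
  set V : ℕ → MvPowerSeries (ℕ+ ⊕ ℕ) K :=
    fun i => ∏ j ∈ s.erase i, (point K i - point K j) with hV
  have hVne : ∀ i, V i ≠ 0 := fun i => Finset.prod_ne_zero_iff.mpr fun j hj =>
    sub_ne_zero.mpr (point_injective.ne (Finset.ne_of_mem_erase hj).symm)
  have hVinv : ∀ i ∈ s, toFrac K (∏ k ∈ s.erase i, V k) = toFrac K (∏ k ∈ s, V k) *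
      (∏ j ∈ s.erase i, (toFrac K (point K i) - toFrac K (point K j)))⁻¹ := by
    intro i hi
    have e : ∏ j ∈ s.erase i, (toFrac K (point K i) - toFrac K (point K j)) = toFrac K (V i) := by
      simp only [hV, map_prod, map_sub]
    rw [e, ← Finset.mul_prod_erase s V hi, map_mul]
    have := (map_ne_zero_iff _ (toFrac_injective (K := K))).mpr (hVne i)
    field_simp
  have hkey : ∀ k, toFrac K (∏ k ∈ s, V k) *
      dividedPower (fun i => toFrac K (point K i)) s (m + k) =
      toFrac K (∑ i ∈ s, (point K i ^ m * ∏ k ∈ s.erase i, V k) * point K i ^ k) := by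
    intro k
    rw [dividedPower, Finset.mul_sum, map_sum]
    refine Finset.sum_congr rfl fun i hi => ?_
    rw [map_mul, map_mul, hVinv i hi, map_pow, map_pow]
    ring
  have key := mul_subst_kpResidue τ s (point K) constantCoeff_point (hasSubst_shift 0)
    (hasSubst_shift s.val) (∏ k ∈ s, V k) (fun i => point K i ^ m * ∏ k ∈ s.erase i, V k) ?_ ?_
  · have hD : ∏ k ∈ s, V k ≠ 0 := Finset.prod_ne_zero_iff.mpr fun i _ => hVne i
    refine (mul_eq_zero.mp ?_).resolve_left hD
    rw [key]
    apply toFrac_injective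
    rw [map_zero, ← mul_zero (toFrac K (∏ k ∈ s, V k)), ← hτ.sum_tauAt_eq_zero h0 m s hs 0,
      Finset.mul_sum, map_sum]
    refine Finset.sum_congr rfl fun i hi => ?_
    have e₁ : shift K s.val - bracket (point K i) = shift K ((s.erase i).val + 0) := by
      rw [sub_eq_iff_eq_add, ← shift_cons, add_zero, Finset.erase_val, Multiset.cons_erase hi]
    rw [e₁, ← shift_cons, map_mul, map_mul, hVinv i hi, map_pow, map_mul, tauAt, tauAt]
    ring
  · intro n
    apply toFrac_injective
    rw [← hkey, map_mul, coeff_expXi_shift s (m + 1) hs]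
    congr 2
    omega
  · apply toFrac_injective
    have := hkey 0
    simp only [pow_zero, mul_one, add_zero] at this
    -- The weights sum to zero because `m` is one less than `s.card - 1`.
    rw [← this, dividedPower_eq_ite _ toFrac_point_injective _ _ (by omega), if_neg (by omega),
      mul_zero, map_zero]

end Points

/-! ### Triangularity of products of power sums -/

section PowerSums

/-- The monomial in the times recorded by the factor `Xₖᵐ`: a power `xₙᵐ` gives `tₙᵐ`, and a
power `aᵢᵐ` with `m > 0` gives `t'ₘ`. -/
def cell : ℕ+ ⊕ ℕ → ℕ → (ℕ+ ⊕ ℕ+ →₀ ℕ)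
  | Sum.inl n, m => Finsupp.single (Sum.inl n) m
  | Sum.inr _, 0 => 0
  | Sum.inr _, m + 1 => Finsupp.single (Sum.inr m.succPNat) 1

/-- The monomial in the times recorded by a monomial in the `xₙ` and the `aᵢ`. -/
def exponentType (e : ℕ+ ⊕ ℕ →₀ ℕ) : ℕ+ ⊕ ℕ+ →₀ ℕ := e.sum cell

/-- The degree of a monomial in the variables `t'`. -/
def len : (ℕ+ ⊕ ℕ+ →₀ ℕ) →+ ℕ := Finsupp.weight (Sum.elim (fun _ => 0) (fun _ => 1))

theorem cell_zero (k : ℕ+ ⊕ ℕ) : cell k 0 = 0 := by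
  cases k <;> simp [cell]

theorem cell_inr (i : ℕ) (n : ℕ+) : cell (Sum.inr i) n = Finsupp.single (Sum.inr n) 1 := by
  obtain ⟨m, rfl⟩ : ∃ m : ℕ, n = m.succPNat := ⟨n.natPred, by simp⟩
  rfl

theorem wt_single_inl (n : ℕ+) (m : ℕ) : wt (Finsupp.single (Sum.inl n) m) = m * n := by
  simp [wt, Finsupp.weight_single]

theorem wt_single_inr (n : ℕ+) (m : ℕ) : wt (Finsupp.single (Sum.inr n) m) = m * n := by
  simp [wt, Finsupp.weight_single]

theorem len_single_inl (n : ℕ+) (m : ℕ) : len (Finsupp.single (Sum.inl n) m) = 0 := by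
  simp [len, Finsupp.weight_single]

theorem len_single_inr (n : ℕ+) (m : ℕ) : len (Finsupp.single (Sum.inr n) m) = m := by
  simp [len, Finsupp.weight_single]

theorem len_le_wt (d : ℕ+ ⊕ ℕ+ →₀ ℕ) : len d ≤ wt d := by
  induction d using Finsupp.induction_linear with
  | zero => simp
  | add f g hf hg => rw [map_add, map_add]; omega
  | single k m =>
    rcases k with n | n
    · rw [len_single_inl]; omega
    · rw [len_single_inr, wt_single_inr]
      exact Nat.le_mul_of_pos_right _ n.pos

theorem wt_cell_add (k : ℕ+ ⊕ ℕ) (m₁ m₂ : ℕ) :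
    wt (cell k (m₁ + m₂)) = wt (cell k m₁) + wt (cell k m₂) := by
  have h : ∀ i m, wt (cell (Sum.inr i) m) = m := by
    rintro i (_ | m)
    · simp [cell]
    · simp [cell, wt_single_inr]
  rcases k with n | i
  · simp [cell, wt_single_inl]
  · rw [h, h, h]

theorem len_cell_add_le (k : ℕ+ ⊕ ℕ) (m₁ m₂ : ℕ) :
    len (cell k (m₁ + m₂)) ≤ len (cell k m₁) + len (cell k m₂) := by
  rcases k with n | i
  · simp [cell, len_single_inl]
  · rcases m₁ with _ | m₁
    · simp [cell_zero]
    · rw [show m₁ + 1 + m₂ = (m₁ + m₂) + 1 by omega]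
      simp [cell, len_single_inr]

/-- Two positive powers of the same point merge into a single part and lose length, so equality
forces one exponent to be zero. -/
theorem cell_add_of_len_eq (k : ℕ+ ⊕ ℕ) (m₁ m₂ : ℕ)
    (h : len (cell k (m₁ + m₂)) = len (cell k m₁) + len (cell k m₂)) :
    cell k (m₁ + m₂) = cell k m₁ + cell k m₂ := by
  rcases k with n | i
  · simp [cell]
  · rcases m₁ with _ | m₁
    · simp [cell_zero]
    · rcases m₂ with _ | m₂
      · simp [cell_zero]
      · rw [show m₁ + 1 + (m₂ + 1) = (m₁ + m₂ + 1) + 1 by omega] at h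
        simp [cell, len_single_inr] at h

theorem exponentType_eq_sum {e : ℕ+ ⊕ ℕ →₀ ℕ} {T : Finset (ℕ+ ⊕ ℕ)} (hT : e.support ⊆ T) :
    exponentType e = ∑ k ∈ T, cell k (e k) :=
  Finsupp.sum_of_support_subset _ hT _ fun k _ => cell_zero k

theorem exponentType_zero : exponentType 0 = 0 := Finsupp.sum_zero_index

theorem exponentType_single (k : ℕ+ ⊕ ℕ) (m : ℕ) :
    exponentType (Finsupp.single k m) = cell k m := Finsupp.sum_single_index (cell_zero k)

theorem exponentType_add_eq_sum (e₁ e₂ : ℕ+ ⊕ ℕ →₀ ℕ) : ∃ T : Finset (ℕ+ ⊕ ℕ),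
    exponentType e₁ = ∑ k ∈ T, cell k (e₁ k) ∧ exponentType e₂ = ∑ k ∈ T, cell k (e₂ k) ∧
      exponentType (e₁ + e₂) = ∑ k ∈ T, cell k (e₁ k + e₂ k) := by
  classical
  exact ⟨e₁.support ∪ e₂.support, exponentType_eq_sum Finset.subset_union_left,
    exponentType_eq_sum Finset.subset_union_right, exponentType_eq_sum Finsupp.support_add⟩

theorem exponentType_add (e₁ e₂ : ℕ+ ⊕ ℕ →₀ ℕ)
    (h : ∀ k, cell k (e₁ k + e₂ k) = cell k (e₁ k) + cell k (e₂ k)) :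
    exponentType (e₁ + e₂) = exponentType e₁ + exponentType e₂ := by
  obtain ⟨T, h₁, h₂, h₃⟩ := exponentType_add_eq_sum e₁ e₂
  rw [h₁, h₂, h₃, ← Finset.sum_add_distrib]
  exact Finset.sum_congr rfl fun k _ => h k

theorem wt_exponentType_add (e₁ e₂ : ℕ+ ⊕ ℕ →₀ ℕ) :
    wt (exponentType (e₁ + e₂)) = wt (exponentType e₁) + wt (exponentType e₂) := by
  obtain ⟨T, h₁, h₂, h₃⟩ := exponentType_add_eq_sum e₁ e₂
  rw [h₁, h₂, h₃, map_sum, map_sum, map_sum, ← Finset.sum_add_distrib]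
  exact Finset.sum_congr rfl fun k _ => wt_cell_add k _ _

theorem len_exponentType_add_le (e₁ e₂ : ℕ+ ⊕ ℕ →₀ ℕ) :
    len (exponentType (e₁ + e₂)) ≤ len (exponentType e₁) + len (exponentType e₂) := by
  obtain ⟨T, h₁, h₂, h₃⟩ := exponentType_add_eq_sum e₁ e₂
  rw [h₁, h₂, h₃, map_sum, map_sum, map_sum, ← Finset.sum_add_distrib]
  exact Finset.sum_le_sum fun k _ => len_cell_add_le k _ _

theorem exponentType_add_of_len_eq (e₁ e₂ : ℕ+ ⊕ ℕ →₀ ℕ)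
    (h : len (exponentType (e₁ + e₂)) = len (exponentType e₁) + len (exponentType e₂)) :
    exponentType (e₁ + e₂) = exponentType e₁ + exponentType e₂ := by
  obtain ⟨T, h₁, h₂, h₃⟩ := exponentType_add_eq_sum e₁ e₂
  rw [h₁, h₂, h₃, map_sum, map_sum, map_sum, ← Finset.sum_add_distrib,
    Finset.sum_eq_sum_iff_of_le fun k _ => len_cell_add_le k _ _] at h
  rw [h₁, h₂, h₃, ← Finset.sum_add_distrib]
  exact Finset.sum_congr rfl fun k hk => cell_add_of_len_eq k _ _ (h k hk)

theorem exponentType_surjective : Function.Surjective exponentType := by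
  have step : ∀ k d, (∃ e, exponentType e = d) →
      ∃ e, exponentType e = Finsupp.single k 1 + d := by
    rintro k _ ⟨e, rfl⟩
    rcases k with n | n
    · refine ⟨Finsupp.single (Sum.inl n) 1 + e, ?_⟩
      rw [exponentType_add, exponentType_single]
      · rfl
      · rintro (l | i)
        · simp [cell]
        · simp [cell_zero]
    -- A point absent from `e` carries the new part, so that nothing merges.
    · obtain ⟨i, hi⟩ := Infinite.exists_notMem_finset (e.support.preimage Sum.inr
        Sum.inr_injective.injOn)
      have hi' : e (Sum.inr i) = 0 := by simpa using hi
      refine ⟨Finsupp.single (Sum.inr i) (n : ℕ) + e, ?_⟩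
      rw [exponentType_add, exponentType_single, cell_inr]
      intro k
      by_cases hk : k = Sum.inr i
      · subst hk
        simp [hi', cell_zero]
      · simp [Finsupp.single_eq_of_ne hk, cell_zero]
  intro d
  induction d using Finsupp.induction with
  | zero => exact ⟨0, exponentType_zero⟩
  | single_add a b f _ hb ih =>
    clear hb
    induction b with
    | zero => simpa using ih
    | succ b ihb =>
      rw [add_comm b 1, Finsupp.single_add, add_assoc]
      exact step a _ ihb

/-- The power sums in the points `aᵢ`, `i ∈ s`, together with the variables `xₙ`. -/
def powerSum (s : Finset ℕ) : ℕ+ ⊕ ℕ+ → MvPowerSeries (ℕ+ ⊕ ℕ) ℕ :=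
  Sum.elim (fun n => X (Sum.inl n)) fun n => ∑ i ∈ s, X (Sum.inr i) ^ (n : ℕ)

/-- The product of power sums with exponents `d`. -/
def powerSumProd (s : Finset ℕ) (d : ℕ+ ⊕ ℕ+ →₀ ℕ) : MvPowerSeries (ℕ+ ⊕ ℕ) ℕ :=
  d.prod fun k m => powerSum s k ^ m

theorem powerSumProd_add (s : Finset ℕ) (d₁ d₂ : ℕ+ ⊕ ℕ+ →₀ ℕ) :
    powerSumProd s (d₁ + d₂) = powerSumProd s d₁ * powerSumProd s d₂ :=
  Finsupp.prod_add_index' (fun _ => pow_zero _) fun _ _ _ => pow_add _ _ _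

theorem powerSumProd_single (s : Finset ℕ) (k : ℕ+ ⊕ ℕ+) (m : ℕ) :
    powerSumProd s (Finsupp.single k m) = powerSum s k ^ m :=
  Finsupp.prod_single_index (pow_zero _)

/-- `d` is obtained from `d'` by splitting variables `t'`. -/
def Refines (d' d : ℕ+ ⊕ ℕ+ →₀ ℕ) : Prop :=
  wt d' = wt d ∧ len d' ≤ len d ∧ (len d' = len d → d' = d)

/-- A monomial of the product picks one point from each power sum. Repeated points merge parts,
which keeps the weight and lowers the length; without repetition the type is `d` itself. -/
theorem refines_of_coeff_ne_zero (s : Finset ℕ) (d : ℕ+ ⊕ ℕ+ →₀ ℕ) (e : ℕ+ ⊕ ℕ →₀ ℕ)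
    (h : coeff e (powerSumProd s d) ≠ 0) : Refines (exponentType e) d := by
  classical
  have hadd : ∀ d₁ d₂, (∀ e, coeff e (powerSumProd s d₁) ≠ 0 → Refines (exponentType e) d₁) →
      (∀ e, coeff e (powerSumProd s d₂) ≠ 0 → Refines (exponentType e) d₂) →
      ∀ e, coeff e (powerSumProd s (d₁ + d₂)) ≠ 0 → Refines (exponentType e) (d₁ + d₂) := by
    intro d₁ d₂ h₁ h₂ e he
    rw [powerSumProd_add, coeff_mul] at he
    obtain ⟨⟨e₁, e₂⟩, hp, hne⟩ := Finset.exists_ne_zero_of_sum_ne_zero he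
    rw [Finset.HasAntidiagonal.mem_antidiagonal] at hp
    obtain ⟨w₁, l₁, q₁⟩ := h₁ e₁ (left_ne_zero_of_mul hne)
    obtain ⟨w₂, l₂, q₂⟩ := h₂ e₂ (right_ne_zero_of_mul hne)
    simp only at hp
    subst hp
    have hl := len_exponentType_add_le e₁ e₂
    refine ⟨?_, ?_, fun hq => ?_⟩
    · rw [wt_exponentType_add, map_add, w₁, w₂]
    · rw [map_add]; omega
    · rw [map_add] at hq
      rw [exponentType_add_of_len_eq e₁ e₂ (by omega), q₁ (by omega), q₂ (by omega)]
  have hzero : ∀ e, coeff e (powerSumProd s 0) ≠ 0 → Refines (exponentType e) 0 := by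
    intro e he
    rw [powerSumProd, Finsupp.prod_zero_index, coeff_one] at he
    obtain rfl : e = 0 := by by_contra h; simp [h] at he
    rw [exponentType_zero]
    exact ⟨rfl, le_rfl, fun _ => rfl⟩
  have hone : ∀ k e, coeff e (powerSumProd s (Finsupp.single k 1)) ≠ 0 →
      Refines (exponentType e) (Finsupp.single k 1) := by
    intro k e he
    have : exponentType e = Finsupp.single k 1 := by
      rw [powerSumProd_single, pow_one] at he
      rcases k with n | n
      · rw [powerSum, Sum.elim_inl, coeff_X] at he
        obtain rfl : e = Finsupp.single (Sum.inl n) 1 := by by_contra h; simp [h] at he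
        exact exponentType_single _ _
      · rw [powerSum, Sum.elim_inr, map_sum] at he
        obtain ⟨i, _, hi⟩ := Finset.exists_ne_zero_of_sum_ne_zero he
        rw [coeff_X_pow] at hi
        obtain rfl : e = Finsupp.single (Sum.inr i) (n : ℕ) := by by_contra h; simp [h] at hi
        rw [exponentType_single, cell_inr]
    rw [this]
    exact ⟨rfl, le_rfl, fun _ => rfl⟩
  induction d using Finsupp.induction_linear generalizing e with
  | zero => exact hzero e h
  | add d₁ d₂ h₁ h₂ => exact hadd d₁ d₂ h₁ h₂ e h
  | single k m =>
    induction m generalizing e with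
    | zero =>
      rw [Finsupp.single_zero] at h ⊢
      exact hzero e h
    | succ m ih =>
      rw [Finsupp.single_add] at h ⊢
      exact hadd _ _ ih (hone k) e h

/-- The coefficients lie in `ℕ`, so nothing cancels and one positive contribution suffices. -/
theorem coeff_powerSumProd_exponentType_ne_zero (s : Finset ℕ) (e : ℕ+ ⊕ ℕ →₀ ℕ)
    (he : ∀ i, Sum.inr i ∈ e.support → i ∈ s) :
    coeff e (powerSumProd s (exponentType e)) ≠ 0 := by
  classical
  induction e using Finsupp.induction with
  | zero => simp [exponentType_zero, powerSumProd]
  | single_add a b f ha hb ih =>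
    have hsupp := Finsupp.support_single_add ha hb
    have hfa : f a = 0 := Finsupp.notMem_support_iff.mp ha
    rw [exponentType_add, powerSumProd_add, coeff_mul, exponentType_single]
    · have h₁ : coeff (Finsupp.single a b) (powerSumProd s (cell a b)) ≠ 0 := by
        rcases a with n | i
        · rw [cell, powerSumProd_single, powerSum, Sum.elim_inl, coeff_X_pow, if_pos rfl]
          exact one_ne_zero
        · obtain ⟨b, rfl⟩ : ∃ n : ℕ+, b = n := ⟨⟨b, Nat.pos_of_ne_zero hb⟩, rfl⟩
          rw [cell_inr, powerSumProd_single, powerSum, Sum.elim_inr, pow_one, map_sum]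
          refine (Finset.sum_pos_iff.mpr ⟨i, he i (by simp [hsupp]), ?_⟩).ne'
          rw [coeff_X_pow, if_pos rfl]
          exact one_pos
      have h₂ := ih fun i hi => he i (by rw [hsupp]; exact Finset.mem_cons_of_mem hi)
      refine (Finset.sum_pos_iff.mpr ⟨(Finsupp.single a b, f), ?_, ?_⟩).ne'
      · rw [Finset.HasAntidiagonal.mem_antidiagonal]
      · exact Nat.pos_of_ne_zero (mul_ne_zero h₁ h₂)
    · intro k
      by_cases hk : k = a
      · subst hk
        simp [hfa, cell_zero]
      · simp [Finsupp.single_eq_of_ne hk, cell_zero]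

end PowerSums

/-! ### Independence of the power sums and the converse implication -/

section Independence

variable {K : Type*} [Field K]

/-- `xₙ` and `∑_{i ∈ s} aᵢⁿ / n`. -/
def pointTimes (K : Type*) [Field K] (s : Finset ℕ) : ℕ+ ⊕ ℕ+ → MvPowerSeries (ℕ+ ⊕ ℕ) K :=
  Sum.elim (baseTime K) (s.val.map fun i => bracket (point K i)).sum

theorem hasSubst_pointTimes (s : Finset ℕ) : HasSubst (pointTimes K s) := by
  refine hasSubst_sumElim (hasSubst_X Sum.inl_injective) ?_
  generalize s.val = C
  induction C using Multiset.induction_on with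
  | empty => exact HasSubst.zero
  | cons i C ih =>
    rw [Multiset.map_cons, Multiset.sum_cons]
    exact (hasSubst_bracket (constantCoeff_point i)).add ih

theorem pointTimes_eq_smul (s : Finset ℕ) (k : ℕ+ ⊕ ℕ+) :
    pointTimes K s k = (Sum.elim (fun _ => 1) (fun n : ℕ+ => ((n : ℕ) : K)⁻¹) k : K) •
      map (Nat.castRingHom K) (powerSum s k) := by
  rcases k with n | n
  · simp [pointTimes, powerSum, baseTime]
  · have : (s.val.map fun i => bracket (point K i)).sum n = ∑ i ∈ s, bracket (point K i) n :=
      Finset.sum_apply n s fun i => bracket (point K i)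
    simp only [pointTimes, powerSum, Sum.elim_inr]
    rw [this]
    simp [bracket, point, Finset.smul_sum]

theorem prod_pointTimes (s : Finset ℕ) (d : ℕ+ ⊕ ℕ+ →₀ ℕ) :
    (d.prod fun k m => pointTimes K s k ^ m) =
      (d.prod fun k m => (Sum.elim (fun _ => 1) (fun n : ℕ+ => ((n : ℕ) : K)⁻¹) k : K) ^ m) •
        map (Nat.castRingHom K) (powerSumProd s d) := by
  simp only [pointTimes_eq_smul, powerSumProd, Finsupp.prod, smul_pow, map_prod, map_pow,
    Finset.prod_smul]

theorem coeff_prod_pointTimes_eq_zero_iff [CharZero K] (s : Finset ℕ) (d : ℕ+ ⊕ ℕ+ →₀ ℕ)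
    (e : ℕ+ ⊕ ℕ →₀ ℕ) : coeff e (d.prod fun k m => pointTimes K s k ^ m) = 0 ↔
      coeff e (powerSumProd s d) = 0 := by
  rw [prod_pointTimes, coeff_smul, coeff_map, mul_eq_zero]
  have : (d.prod fun k m =>
      (Sum.elim (fun _ => 1) (fun n : ℕ+ => ((n : ℕ) : K)⁻¹) k : K) ^ m) ≠ 0 := by
    refine Finset.prod_ne_zero_iff.mpr fun k _ => pow_ne_zero _ ?_
    rcases k with n | n
    · exact one_ne_zero
    · exact inv_ne_zero (Nat.cast_ne_zero.mpr n.ne_zero)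
  simp [this]

/-- A power series in `t, t'` that vanishes at `t = x`, `t' = ∑_{i ∈ s} [aᵢ]` for all large `s` is
zero. -/
theorem eq_zero_of_subst_pointTimes [CharZero K] (F : MvPowerSeries (ℕ+ ⊕ ℕ+) K)
    (hF : ∀ s : Finset ℕ, 2 ≤ s.card → subst (pointTimes K s) F = 0) : F = 0 := by
  by_contra hne
  obtain ⟨d₁, hd₁⟩ : ∃ d, coeff d F ≠ 0 := by
    by_contra! h
    exact hne (MvPowerSeries.ext h)
  -- Among the monomials of `F` of one fixed weight, `d₀` has the greatest length; by `len_le_wt`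
  -- the subtraction is not truncated.
  obtain ⟨d₀, ⟨hd₀, hw₀⟩, hmin⟩ := WellFounded.has_min
    (measure fun d : ℕ+ ⊕ ℕ+ →₀ ℕ => wt d - len d).wf {d | coeff d F ≠ 0 ∧ wt d = wt d₁}
    ⟨d₁, hd₁, rfl⟩
  obtain ⟨e, rfl⟩ := exponentType_surjective d₀
  set s := Finset.range (e.support.sup (Sum.elim (fun _ => 0) id) + 2) with hs
  have hes : ∀ i, Sum.inr i ∈ e.support → i ∈ s := by
    intro i hi
    have : i ≤ e.support.sup (Sum.elim (fun _ => 0) id) :=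
      Finset.le_sup (f := Sum.elim (fun _ => 0) id) hi
    rw [hs, Finset.mem_range]
    omega
  have h := congrArg (coeff e) (hF s (by rw [hs, Finset.card_range]; omega))
  rw [coeff_subst (hasSubst_pointTimes s), finsum_eq_single _ (exponentType e), map_zero,
    smul_eq_mul, mul_eq_zero, coeff_prod_pointTimes_eq_zero_iff] at h
  · exact h.elim hd₀ (coeff_powerSumProd_exponentType_ne_zero s e hes)
  -- Any other contributing `d` has the same weight and at least the length of `d₀`, hence equal
  -- length by maximality, hence `d = d₀`.
  · intro d hd
    by_contra hcd
    rw [smul_eq_mul, mul_eq_zero, coeff_prod_pointTimes_eq_zero_iff, not_or] at hcd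
    obtain ⟨hw, hl, hq⟩ := refines_of_coeff_ne_zero s d e hcd.2
    have hlt := hmin d ⟨hcd.1, hw.symm.trans hw₀⟩
    have hle := len_le_wt d
    simp only [InvImage, WellFoundedRelation.rel] at hlt
    exact hd (hq (by omega)).symm

theorem ThreeTermEquation.isKPTau [CharZero K] {τ : MvPowerSeries ℕ+ K}
    (hτ : ThreeTermEquation τ) : IsKPTau τ := by
  change kpResidue τ = 0
  -- The addition formula was obtained by cancelling values of `τ`, so `τ = 0` is separate.
  rcases eq_or_ne τ 0 with rfl | h0
  · have h : tauFactor (0 : MvPowerSeries ℕ+ K) = 0 := by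
      have : eval (0 : MvPowerSeries ℕ+ K) (t K + bracket (lamInv K)) = 0 := by
        rw [eval, ← coe_substAlgHom (hasSubst_t_add K), map_zero]
      rw [tauFactor, this, mul_zero, map_zero]
    ext d
    change ∑ᶠ i : ℤ, _ = _
    simp [h, inLamInv]
  set y : ℕ+ → MvPowerSeries (ℕ+ ⊕ ℕ+) K := fun n => X (Sum.inl n)
  set y' : ℕ+ → MvPowerSeries (ℕ+ ⊕ ℕ+) K := fun n => X (Sum.inr n)
  have hy : HasSubst y := hasSubst_X Sum.inl_injective
  have hy' : HasSubst y' := hasSubst_X Sum.inr_injective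
  -- The vanishing is known at `t' = x + ∑ [aᵢ]`, the independence lemma needs `t' = ∑ [aᵢ]`: the
  -- invertible change `t' ↦ t + t'` passes between them, and `hsub` undoes it.
  have hadd : HasSubst (Sum.elim y (y + y')) := hasSubst_sumElim hy (hy.add hy')
  have hsub : HasSubst (Sum.elim y (y' - y)) := by
    refine hasSubst_sumElim hy ?_
    convert hy'.add (hy.smul (-1)) using 1
    funext n
    simp [sub_eq_add_neg]
  have hF := eq_zero_of_subst_pointTimes (subst (Sum.elim y (y + y')) (kpResidue τ)) fun s hs => by
    have hp := hasSubst_pointTimes (K := K) s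
    rw [subst_comp_subst_apply hadd hp,
      ← hτ.subst_kpResidue_eq_zero h0 (s.card - 2) s (by omega)]
    congr 1
    funext k
    rcases k with n | n
    · rw [Sum.elim_inl, subst_X hp]
      simp [pointTimes, shift]
    · rw [Sum.elim_inr, Pi.add_apply, subst_add hp, subst_X hp, subst_X hp]
      rfl
  have := congrArg (subst (Sum.elim y (y' - y))) hF
  rw [subst_comp_subst_apply hadd hsub, ← coe_substAlgHom hsub, map_zero, coe_substAlgHom hsub]
    at this
  convert this using 1
  have e : (fun k => subst (Sum.elim y (y' - y)) (Sum.elim y (y + y') k)) = X := by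
    funext k
    rcases k with n | n
    · rw [Sum.elim_inl, subst_X hsub]
      rfl
    · rw [Sum.elim_inr, Pi.add_apply, subst_add hsub, subst_X hsub, subst_X hsub]
      simp [y, y']
  rw [e, subst_self, id]

end Independence

end KP

end

theorem theorem1 {K : Type*} [Field K] [CharZero K] (τ : MvPowerSeries ℕ+ K) :
    KP.ThreeTermEquation τ ↔ KP.IsKPTau τ :=
  ⟨fun h => h.isKPTau, KP.threeTermEquation_of_isKPTau⟩
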